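/- Theorem A. Let $(R,\mathfrak m)$ be a commutative noetherian local ring; all modules are finitely generated $R$-modules. A homomorphism $f\colon M\to N$ is a split monomorphism (split epimorphism) if it has an $R$-linear left (right) inverse. It is called irreducible if it is neither a split monomorphism nor a split epimorphism, and for every factorization $f=hg$ with $g\colon M\to L$, $h\colon L\to N$ and $L$ a finitely generated $R$-module, $g$ is a split monomorphism or $h$ is a split epimorphism. (a) Let $I$ be a nonzero proper ideal of $R$ that is a direct summand of $\mathfrak m$, i.e. $\mathfrak m=I\oplus J$ for some ideal $J$ of $R$. Then the inclusion map $I\to R$ is an irreducible homomorphism. (b) Assume that $R$ is Henselian, and let $\phi\colon M\to F$ be an irreducible monomorphism of $R$-modules with $F$ free such that $\operatorname{Im}(\phi)\subseteq\mathfrak mF$. Then the following hold. (b1) The $R$-module $M$ is isomorphic to a direct summand of $\mathfrak m$. (b2) If $M$ is indecomposable, then for every surjective homomorphism $\pi\colon F\to R$ there exists a split monomorphism $\eta\colon M\to\mathfrak m$ such that $\pi\phi=\theta\eta$, where $\theta\colon\mathfrak m\to R$ is the inclusion map. -/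

import Mathlib

universe u

namespace IrredFree

section General

variable {R : Type u} [CommRing R]
variable {M N : Type u} [AddCommGroup M] [Module R M] [AddCommGroup N] [Module R N]

/-- `f` is a split monomorphism: it has a left inverse that is `R`-linear. -/
def IsSplitMono (f : M →ₗ[R] N) : Prop :=
  ∃ g : N →ₗ[R] M, g ∘ₗ f = LinearMap.id

/-- `f` is a split epimorphism: it has a right inverse that is `R`-linear. -/
def IsSplitEpi (f : M →ₗ[R] N) : Prop :=
  ∃ g : N →ₗ[R] M, f ∘ₗ g = LinearMap.id

/-- Irreducible homomorphisms in the category of finitely generated `R`-modules: `f` is neither a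
split monomorphism nor a split epimorphism, and in every factorization `f = h ∘ g` through a
finitely generated module `L`, either `g` is a split monomorphism or `h` is a split epimorphism. -/
structure IsIrreducibleHom (f : M →ₗ[R] N) : Prop where
  not_splitMono : ¬ IsSplitMono f
  not_splitEpi : ¬ IsSplitEpi f
  factor : ∀ (L : Type u) [AddCommGroup L] [Module R L] [Module.Finite R L]
    (g : M →ₗ[R] L) (h : L →ₗ[R] N), h ∘ₗ g = f → IsSplitMono g ∨ IsSplitEpi h

/-- The submodule `A` is an (internal) direct summand of the submodule `B`: `B = A ⊕ C` for some
submodule `C`. -/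
def IsDirectSummand (A B : Submodule R M) : Prop :=
  ∃ C : Submodule R M, A ⊔ C = B ∧ A ⊓ C = ⊥

variable (R M) in
/-- `M` is indecomposable: it is nonzero, and whenever `M = A ⊕ B` (internally), `A` or `B` is
zero. -/
def IsIndecomposable : Prop :=
  Nontrivial M ∧ ∀ A B : Submodule R M, IsCompl A B → A = ⊥ ∨ B = ⊥

end General

end IrredFree

/-!
For (a), let `h ∘ g` be the inclusion of `I`. If `h` is onto `R` it splits, `R` being free;
otherwise `h` lands in the maximal ideal `𝔪`, and following it by the projection `𝔪 → I` gives a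
left inverse of `g`.

For (b), let `π : F → R` be surjective and `L = π⁻¹(𝔪)`. The inclusion `L → F` is not onto, so
irreducibility yields a left inverse `s : L → M` of `φ : M → L`. Choose `e` with `π e = 1` and split
`L = 𝔪 e ⊕ ker π`. This writes `id` on `M` as the sum of `x ↦ s (π (φ x) • e)` and
`x ↦ s (φ x - π (φ x) • e)`. Since `φ` has image in `𝔪 F`, the second summand has image in `𝔪 M`,
so by Nakayama the first one is an automorphism of `M`. As it factors through `π ∘ φ : M → 𝔪`, that
map is a split monomorphism (`IsIrreducibleHom.exists_splitMono_maximalIdeal`). This is (b2).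
Applied to any surjection `F → R`, it gives (b1).
-/

namespace IrredFree

open IsLocalRing

section General

variable {R : Type u} [CommRing R]
variable {M N : Type u} [AddCommGroup M] [Module R M] [AddCommGroup N] [Module R N]

theorem IsSplitEpi.surjective {f : M →ₗ[R] N} (hf : IsSplitEpi f) : Function.Surjective f := by
  obtain ⟨g, hg⟩ := hf
  exact fun y => ⟨g y, LinearMap.congr_fun hg y⟩

theorem IsDirectSummand.exists_projection {A B : Submodule R M} (h : IsDirectSummand A B) :
    ∃ p : B →ₗ[R] A, ∀ (a : A) (ha : (a : M) ∈ B), p ⟨a, ha⟩ = a := by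
  obtain ⟨C, rfl, hinf⟩ := h
  have hc : IsCompl (A.submoduleOf (A ⊔ C)) (C.submoduleOf (A ⊔ C)) := by
    constructor
    · rw [disjoint_iff, Submodule.submoduleOf, Submodule.submoduleOf, ← Submodule.comap_inf, hinf,
        Submodule.comap_bot, Submodule.ker_subtype]
    · rw [codisjoint_iff, ← Submodule.submoduleOf_sup_of_le le_sup_left le_sup_right,
        Submodule.submoduleOf_self]
  refine ⟨(Submodule.submoduleOfEquivOfLe le_sup_left).toLinearMap ∘ₗ
    Submodule.projectionOnto _ _ hc, fun a ha => ?_⟩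
  have := Submodule.projectionOnto_apply_left hc ⟨⟨a, ha⟩, a.2⟩
  exact congrArg (Submodule.submoduleOfEquivOfLe le_sup_left) this

/-- A split monomorphism `η` into a submodule `B` identifies its source with a direct summand
of `B`; a complement is the kernel of a left inverse of `η`. -/
theorem IsSplitMono.exists_isDirectSummand {B : Submodule R N} {η : M →ₗ[R] B}
    (hη : IsSplitMono η) :
    ∃ A : Submodule R N, IsDirectSummand A B ∧ Nonempty (M ≃ₗ[R] A) := by
  obtain ⟨s, hs⟩ := hη
  have hs' : Function.LeftInverse s η := LinearMap.congr_fun hs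
  refine ⟨LinearMap.range (B.subtype ∘ₗ η), ⟨(LinearMap.ker s).map B.subtype, ?_, ?_⟩,
    ⟨LinearEquiv.ofInjective _ (B.injective_subtype.comp hs'.injective)⟩⟩
  · apply le_antisymm
    · rw [sup_le_iff]
      exact ⟨by rintro _ ⟨x, rfl⟩; exact (η x).2, Submodule.map_subtype_le _ _⟩
    · intro b hb
      refine Submodule.mem_sup.2 ⟨_, ⟨s ⟨b, hb⟩, rfl⟩, b - η (s ⟨b, hb⟩),
        ⟨⟨b, hb⟩ - η (s ⟨b, hb⟩), ?_, rfl⟩, ?_⟩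
      · simp [hs' (s ⟨b, hb⟩)]
      · simp
  · rw [eq_bot_iff]
    rintro _ ⟨⟨x, rfl⟩, ⟨y, hy, hyx⟩⟩
    have hy' : y = η x := Subtype.ext hyx
    have hx : x = 0 := by rw [← hs' x, ← hy']; exact hy
    simp [hx]

theorem IsIrreducibleHom.exists_surjective_of_free [Module.Free R N] {f : M →ₗ[R] N}
    (hf : IsIrreducibleHom f) :
    ∃ π : N →ₗ[R] R, Function.Surjective π := by
  cases subsingleton_or_nontrivial N with
  | inl hN => exact absurd ⟨0, Subsingleton.elim _ _⟩ hf.not_splitEpi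
  | inr hN =>
    let b := Module.Free.chooseBasis R N
    obtain ⟨j⟩ := b.index_nonempty
    exact ⟨b.coord j, fun r => ⟨r • b j, by simp⟩⟩

end General

section Local

variable {R : Type u} [CommRing R] [IsLocalRing R]

theorem not_isSplitMono_subtype_of_ne_top {I : Ideal R} (hbot : I ≠ ⊥) (htop : I ≠ ⊤) :
    ¬ IsSplitMono (Submodule.subtype I) := by
  rintro ⟨g, hg⟩
  apply hbot
  rw [eq_bot_iff]
  intro x hx
  -- `e = g 1` lies in `I` and satisfies `x * e = x`, while `1 - e` is a unit.
  have h1 : x * (g 1 : R) = x := by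
    have h2 : g x = ⟨x, hx⟩ := LinearMap.congr_fun hg ⟨x, hx⟩
    have h3 : g x = x • g 1 := by rw [← map_smul, smul_eq_mul, mul_one]
    simpa using congrArg Subtype.val (h3.symm.trans h2)
  have hu : IsUnit (1 - (g 1 : R)) := by
    by_contra hn
    have := (maximalIdeal R).add_mem ((mem_maximalIdeal _).2 hn) (le_maximalIdeal htop (g 1).2)
    rw [sub_add_cancel] at this
    exact (Ideal.ne_top_iff_one _).1 (maximalIdeal.isMaximal R).ne_top this
  exact hu.mul_left_eq_zero.1 (by rw [mul_sub, mul_one, h1, sub_self])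

theorem isIrreducibleHom_subtype_of_isDirectSummand {I : Ideal R} (hbot : I ≠ ⊥) (htop : I ≠ ⊤)
    (hI : IsDirectSummand I (maximalIdeal R)) : IsIrreducibleHom (Submodule.subtype I) where
  not_splitMono := not_isSplitMono_subtype_of_ne_top hbot htop
  not_splitEpi h := htop (by simpa using LinearMap.range_eq_top.2 h.surjective)
  factor L _ _ _ g h hgh := by
    by_cases hh : Function.Surjective h
    · exact Or.inr (Module.projective_lifting_property h LinearMap.id hh)
    · left
      obtain ⟨p, hp⟩ := hI.exists_projection
      have hm : ∀ x, h x ∈ maximalIdeal R := fun x =>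
        le_maximalIdeal (fun ht => hh (LinearMap.range_eq_top.1 ht)) (LinearMap.mem_range_self h x)
      refine ⟨p ∘ₗ h.codRestrict _ hm, LinearMap.ext fun a => ?_⟩
      have hga : h (g a) = a := LinearMap.congr_fun hgh a
      have hcod : h.codRestrict _ hm (g a) = ⟨a, hga ▸ hm (g a)⟩ := Subtype.ext hga
      simp only [LinearMap.comp_apply, hcod, hp, LinearMap.id_apply]

variable [IsNoetherianRing R] {M F : Type u} [AddCommGroup M] [Module R M] [Module.Finite R M]
  [AddCommGroup F] [Module R F]

/-- By Nakayama's lemma, `u` is an automorphism once it is congruent to the identity modulo the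
maximal ideal. -/
theorem bijective_of_add_eq_id {u v : M →ₗ[R] M} (huv : u + v = LinearMap.id)
    (hv : LinearMap.range v ≤ maximalIdeal R • (⊤ : Submodule R M)) : Function.Bijective u := by
  apply IsNoetherian.bijective_of_surjective_endomorphism
  rw [← LinearMap.range_eq_top, eq_top_iff]
  refine Submodule.le_of_le_smul_of_le_jacobson_bot Module.Finite.fg_top
    (maximalIdeal_le_jacobson _) fun x _ => ?_
  rw [← LinearMap.id_apply (R := R) x, ← huv, LinearMap.add_apply]
  exact Submodule.add_mem_sup (LinearMap.mem_range_self u x) (hv (LinearMap.mem_range_self v x))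

/-- An irreducible homomorphism `φ : M → F` into `𝔪 F`, followed by a surjection `F → R`, is a split
monomorphism `M → 𝔪`. -/
theorem IsIrreducibleHom.exists_splitMono_maximalIdeal [Module.Finite R F] {φ : M →ₗ[R] F}
    (hφ : IsIrreducibleHom φ)
    (hrange : LinearMap.range φ ≤ maximalIdeal R • (⊤ : Submodule R F))
    {π : F →ₗ[R] R} (hπ : Function.Surjective π) :
    ∃ η : M →ₗ[R] maximalIdeal R, IsSplitMono η ∧
      π ∘ₗ φ = Submodule.subtype (maximalIdeal R) ∘ₗ η := by
  have hmem : ∀ x, π (φ x) ∈ maximalIdeal R := fun x =>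
    (Submodule.smul_le (P := Submodule.comap π (maximalIdeal R))).2
      (fun r hr y _ => by
        rw [Submodule.mem_comap, map_smul, smul_eq_mul]
        exact Ideal.mul_mem_right _ _ hr)
      (hrange (LinearMap.mem_range_self φ x))
  let L : Submodule R F := Submodule.comap π (maximalIdeal R)
  obtain ⟨e, he⟩ := hπ 1
  obtain ⟨s, hs⟩ : IsSplitMono (φ.codRestrict L hmem) := by
    refine (hφ.factor L (φ.codRestrict L hmem) L.subtype rfl).resolve_right fun h => ?_
    obtain ⟨y, hy⟩ := h.surjective e
    have hmax : π (L.subtype y) ∈ maximalIdeal R := y.2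
    rw [hy, he] at hmax
    exact (Ideal.ne_top_iff_one _).1 (maximalIdeal.isMaximal R).ne_top hmax
  let i : maximalIdeal R →ₗ[R] L :=
    ((LinearMap.toSpanSingleton R F e) ∘ₗ (maximalIdeal R).subtype).codRestrict L
      fun r => by simp [L, he]
  let q : F →ₗ[R] L :=
    (LinearMap.id - (LinearMap.toSpanSingleton R F e) ∘ₗ π).codRestrict L
      fun y => by simp [L, he]
  let η : M →ₗ[R] maximalIdeal R := (π ∘ₗ φ).codRestrict _ hmem
  have hid : s ∘ₗ i ∘ₗ η + s ∘ₗ q ∘ₗ φ = LinearMap.id := by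
    rw [← LinearMap.comp_add, ← hs]
    congr 1
    ext x
    simp [i, q, η]
  have hb : Function.Bijective (s ∘ₗ i ∘ₗ η) := by
    refine bijective_of_add_eq_id hid ?_
    rw [← LinearMap.comp_assoc, LinearMap.range_comp]
    refine (Submodule.map_mono hrange).trans ?_
    rw [Submodule.map_smul'']
    exact Submodule.smul_mono le_rfl le_top
  let E := LinearEquiv.ofBijective _ hb
  exact ⟨η, ⟨E.symm.toLinearMap ∘ₗ s ∘ₗ i, LinearMap.ext fun x => E.symm_apply_apply x⟩, rfl⟩

end Local

end IrredFree

theorem theoremA (R : Type u) [CommRing R] [IsLocalRing R] [IsNoetherianRing R] :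
    -- (a)
    (∀ I : Ideal R, I ≠ ⊥ → I ≠ ⊤ →
      IrredFree.IsDirectSummand I (IsLocalRing.maximalIdeal R) →
      IrredFree.IsIrreducibleHom (Submodule.subtype I)) ∧
    -- (b)
    (HenselianLocalRing R →
      ∀ (M F : Type u) [AddCommGroup M] [Module R M] [Module.Finite R M]
        [AddCommGroup F] [Module R F] [Module.Finite R F] [Module.Free R F]
        (φ : M →ₗ[R] F), Function.Injective φ → IrredFree.IsIrreducibleHom φ →
        LinearMap.range φ ≤ IsLocalRing.maximalIdeal R • (⊤ : Submodule R F) →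
        -- (b1)
        (∃ N : Ideal R, IrredFree.IsDirectSummand N (IsLocalRing.maximalIdeal R) ∧
          Nonempty (M ≃ₗ[R] N)) ∧
        -- (b2)
        (IrredFree.IsIndecomposable R M →
          ∀ π : F →ₗ[R] R, Function.Surjective π →
            ∃ η : M →ₗ[R] IsLocalRing.maximalIdeal R, IrredFree.IsSplitMono η ∧
              π ∘ₗ φ = Submodule.subtype (IsLocalRing.maximalIdeal R) ∘ₗ η)) := by

  refine ⟨fun I hbot htop hI => IrredFree.isIrreducibleHom_subtype_of_isDirectSummand hbot htop hI,
    fun _ M F _ _ _ _ _ _ _ φ _ hφ hrange => ⟨?_, fun _ π hπ =>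
      hφ.exists_splitMono_maximalIdeal hrange hπ⟩⟩
  obtain ⟨π, hπ⟩ := hφ.exists_surjective_of_free
  obtain ⟨η, hη, -⟩ := hφ.exists_splitMono_maximalIdeal hrange hπ
  exact hη.exists_isDirectSummand
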